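/- A \emph{polytope} $P$ is the convex hull of a finite set of points in a Euclidean space $\mathbb{R}^d$. Its \emph{faces} are its intersections with closed halfspaces whose boundary hyperplane misses the relative interior of $P$ (equivalently, the empty set and the sets of maximizers over $P$ of linear functionals); both $\emptyset$ and $P$ are faces. The dimension of a face is the dimension of its affine hull ($-1$ for $\emptyset$); \emph{vertices} are the faces of dimension $0$, and \emph{facets} are the faces of dimension $\dim P-1$. A \emph{$k$-treetope} is a polytope of dimension $k$ that has a facet $B$ (the \emph{base}) such that every face of the polytope that intersects $B$ in at most one point has dimension at most one. \textbf{Corollary.} Every $4$-treetope with $n$ vertices or with $n$ facets has $O(n)$ faces. That is, there is an absolute constant $C$ such that for every $d$, every $4$-treetope $P$ in $\mathbb{R}^d$, and every $n$: if $P$ has exactly $n$ vertices, or if $P$ has exactly $n$ facets, then $P$ has only finitely many faces, and their number (over all dimensions) is at most $Cn$. -/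

import Mathlib

namespace Treetope

variable {E : Type*} [NormedAddCommGroup E] [InnerProductSpace ℝ E]

/-- A polytope is the convex hull of a finite set of points. -/
def IsPolytope (P : Set E) : Prop :=
  ∃ S : Set E, S.Finite ∧ P = convexHull ℝ S

/-- The faces of a polytope `P`: its intersections with closed halfspaces whose boundary hyperplane
misses the relative interior of `P`. Equivalently, these are the exposed subsets of `P`: the empty
set, and the sets of maximizers over `P` of a linear functional. (The zero functional gives `P`.) -/
def faces (P : Set E) : Set (Set E) :=
  {F | IsExposed ℝ P F}

open Classical in
/-- The dimension of a set: the dimension of its affine hull, where the empty set has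
dimension `-1`. -/
noncomputable def dim (F : Set E) : ℤ :=
  if F = ∅ then -1 else (Module.finrank ℝ (vectorSpan ℝ F) : ℤ)

/-- The vertices of `P` are its faces of dimension zero (the sets `{v}`). -/
def vertices (P : Set E) : Set (Set E) :=
  {F | F ∈ faces P ∧ dim F = 0}

/-- The facets of `P` are its faces of dimension one less than that of `P`. -/
def facets (P : Set E) : Set (Set E) :=
  {F | F ∈ faces P ∧ dim F = dim P - 1}

/-- `P` is a treetope with base `B`: `P` is a polytope, `B` is a facet of `P`, and every face of `P`
that meets `B` in at most one point has dimension at most one. -/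
def IsTreetopeWithBase (P B : Set E) : Prop :=
  IsPolytope P ∧ B ∈ facets P ∧
    ∀ F ∈ faces P, (F ∩ B).Subsingleton → dim F ≤ 1

/-- A `k`-treetope is a treetope (with respect to some base facet) of dimension `k`. -/
def IsKTreetope (k : ℕ) (P : Set E) : Prop :=
  (∃ B : Set E, IsTreetopeWithBase P B) ∧ dim P = k

end Treetope

namespace Treetope

/-! ### Faces of a finite vector configuration -/

section ConeFaces

variable {W : Type*} [AddCommGroup W] [Module ℝ W]

/-! Lifting points `x` to `(x, 1)` turns faces of the polytope into zero sets of nonnegative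
functionals on finitely many vectors, with rank equal to dimension plus one. Face counts then become
linear inequalities whose engine is `card_upFaces_le`: the covers of a face `F` on which `ψ` is
positive outside `F` number at most one more than such faces one rank higher. In particular such a
cover is unique if there are no such higher faces.

Let `v, e, p, f` count the vertices, edges, polygons and facets of `P`, and `b₁, b₂, b₃` the
vertices, edges and polygons of the 3-dimensional base. Sweeping the base by a generic functional
gives half of Euler's formula, `b₂ ≤ b₁ + b₃`; with `3b₁ ≤ 2b₂` and `3b₃ ≤ 2b₂` this makes the three
numbers comparable. The treetope condition forces every polygon to meet the base in at least an edge
and every other facet to meet it in a polygon. Uniqueness of covers then charges faces off the base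
injectively: edges to their lowest vertices, polygons to base edges, facets to base polygons. Hence
`e ≤ b₂ + v`, `p ≤ b₃ + b₂`, `f ≤ b₃ + 1`. For the bound in `n` vertices use `b₁ ≤ v`; for facets
use `b₃ ≤ f`, together with `2v ≤ e`, which gives `v ≤ b₂`. -/

/-- A face of a finite vector configuration `V`: the zero set in `V` of a linear functional that is
nonnegative on `V`. -/
def IsFace (V A : Finset W) : Prop :=
  A ⊆ V ∧ ∃ φ : W →ₗ[ℝ] ℝ, ∀ v ∈ V, 0 ≤ φ v ∧ (φ v = 0 ↔ v ∈ A)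

/-- The dimension of the linear span of a finite set of vectors. -/
noncomputable def rk (A : Finset W) : ℕ := Module.finrank ℝ (Submodule.span ℝ (A : Set W))

theorem rk_mono {A C : Finset W} (h : A ⊆ C) : rk A ≤ rk C :=
  have := FiniteDimensional.span_finset ℝ C
  Submodule.finrank_mono (Submodule.span_mono (by exact_mod_cast h))

theorem rk_empty : rk (∅ : Finset W) = 0 := by simp [rk]

theorem mem_span_of_rk_le {A C : Finset W} (hAC : A ⊆ C) {x : W} (hx : x ∈ C)
    (hxA : x ∉ Submodule.span ℝ (A : Set W)) (hr : rk C ≤ rk A + 1) {y : W} (hy : y ∈ C) :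
    ∃ a : ℝ, ∃ z ∈ Submodule.span ℝ (A : Set W), y = a • x + z := by
  classical
  have hlt : rk A < rk (insert x A) := by
    have := FiniteDimensional.span_finset ℝ (insert x A)
    refine Submodule.finrank_lt_finrank_of_lt ?_
    refine lt_of_le_of_ne (Submodule.span_mono (by simp)) fun h => hxA ?_
    rw [h]
    exact Submodule.subset_span (by simp)
  have hle : insert x A ⊆ C := Finset.insert_subset hx hAC
  have := FiniteDimensional.span_finset ℝ C
  have heq : Submodule.span ℝ ((insert x A : Finset W) : Set W) = Submodule.span ℝ (C : Set W) :=
    Submodule.eq_of_le_of_finrank_le (Submodule.span_mono (by exact_mod_cast hle))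
      (by have := rk_mono hle; unfold rk at *; omega)
  have : y ∈ Submodule.span ℝ ((insert x A : Finset W) : Set W) := heq ▸ Submodule.subset_span hy
  rwa [Finset.coe_insert, Submodule.mem_span_insert] at this

theorem eq_zero_of_mem_span {A : Finset W} {φ : W →ₗ[ℝ] ℝ} (h : ∀ x ∈ A, φ x = 0) {x : W}
    (hx : x ∈ Submodule.span ℝ (A : Set W)) : φ x = 0 := by
  have : Submodule.span ℝ (A : Set W) ≤ LinearMap.ker φ := Submodule.span_le.2 fun y hy => h y hy
  exact this hx

namespace IsFace

variable {V A C : Finset W}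

theorem subset (h : IsFace V A) : A ⊆ V := h.1

theorem self (V : Finset W) : IsFace V V := ⟨subset_rfl, 0, fun v hv => by simp [hv]⟩

theorem mono {V' : Finset W} (h : IsFace V A) (hA : A ⊆ V') (hV : V' ⊆ V) : IsFace V' A := by
  obtain ⟨-, φ, hφ⟩ := h
  exact ⟨hA, φ, fun v hv => hφ v (hV hv)⟩

theorem inter [DecidableEq W] (h : IsFace V A) (h' : IsFace V C) : IsFace V (A ∩ C) := by
  obtain ⟨hA, φ, hφ⟩ := h
  obtain ⟨hC, ψ, hψ⟩ := h'
  refine ⟨Finset.inter_subset_left.trans hA, φ + ψ, fun v hv => ?_⟩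
  have h1 := hφ v hv
  have h2 := hψ v hv
  rw [Finset.mem_inter, ← h1.2, ← h2.2, LinearMap.add_apply]
  refine ⟨by linarith, fun h => ⟨by linarith, by linarith⟩, fun h => by linarith⟩

/-- A large multiple of the functional cutting out `C` makes the functional of `A` positive off `C`
without changing it on `C`. -/
theorem trans (hA : IsFace C A) (hC : IsFace V C) : IsFace V A := by
  obtain ⟨hA, φ, hφ⟩ := hA
  obtain ⟨hC, ψ, hψ⟩ := hC
  obtain ⟨N, hN⟩ : ∃ N : ℝ, ∀ v ∈ V, v ∉ C → 0 < φ v + N * ψ v := by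
    obtain ⟨N, hN⟩ := (V.image fun v => (1 - φ v) / ψ v).bddAbove
    refine ⟨N, fun v hv hvC => ?_⟩
    have h1 := hψ v hv
    have hpos : 0 < ψ v := lt_of_le_of_ne h1.1 fun h => hvC (h1.2.1 h.symm)
    have := hN (Finset.mem_coe.2 (Finset.mem_image_of_mem _ hv))
    simp only [div_le_iff₀ hpos] at this
    linarith
  refine ⟨hA.trans hC, φ + N • ψ, fun v hv => ?_⟩
  simp only [LinearMap.add_apply, LinearMap.smul_apply, smul_eq_mul]
  by_cases hvC : v ∈ C
  · rw [(hψ v hv).2.2 hvC]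
    simpa using hφ v hvC
  · have := hN v hv hvC
    exact ⟨this.le, fun h => absurd h this.ne', fun h => absurd (hA h) hvC⟩

theorem notMem_span (h : IsFace V A) {x : W} (hx : x ∈ V) (hxA : x ∉ A) :
    x ∉ Submodule.span ℝ (A : Set W) := by
  obtain ⟨hA, φ, hφ⟩ := h
  intro hs
  exact hxA ((hφ x hx).2.1 (eq_zero_of_mem_span (fun y hy => (hφ y (hA hy)).2.2 hy) hs))

theorem rk_lt (h : IsFace V A) (hAC : A ⊂ C) (hC : C ⊆ V) : rk A < rk C := by
  obtain ⟨x, hx, hxA⟩ := Finset.exists_of_ssubset hAC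
  have := FiniteDimensional.span_finset ℝ C
  refine Submodule.finrank_lt_finrank_of_lt ?_
  refine lt_of_le_of_ne (Submodule.span_mono (by exact_mod_cast hAC.1)) fun he => ?_
  exact h.notMem_span (hC hx) hxA (he ▸ Submodule.subset_span hx)

theorem eq_of_rk_le (h : IsFace V A) (hAC : A ⊆ C) (hC : C ⊆ V) (hr : rk C ≤ rk A) : A = C := by
  by_contra hne
  exact absurd (h.rk_lt (hAC.ssubset_of_ne hne) hC) (by omega)

/-- Gift wrapping: tilt the functional `φ` of `A` by `ψ` until it first touches new vectors. The
face reached is where `ψ / φ` attains its minimum `r < 0`, together with `A`; on it `ψ = r φ`. -/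
theorem exists_neg (h : IsFace V A) {ψ : W →ₗ[ℝ] ℝ} (hψ : ∀ x ∈ A, ψ x = 0)
    (hneg : ∃ w ∈ V, ψ w < 0) :
    ∃ G, IsFace V G ∧ A ⊂ G ∧ ∀ x ∈ G, x ∉ A → ψ x < 0 := by
  classical
  obtain ⟨hA, φ, hφ⟩ := h
  obtain ⟨w, hw, hwn⟩ := hneg
  have hwA : w ∉ A := fun hh => by simp [hψ w hh] at hwn
  have hpos : ∀ v ∈ V, v ∉ A → 0 < φ v := fun v hv hvA =>
    lt_of_le_of_ne (hφ v hv).1 fun h => hvA ((hφ v hv).2.1 h.symm)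
  obtain ⟨m, hm, hmin⟩ := Finset.exists_min_image (V \ A) (fun v => ψ v / φ v)
    ⟨w, Finset.mem_sdiff.2 ⟨hw, hwA⟩⟩
  rw [Finset.mem_sdiff] at hm
  set r := ψ m / φ m with hr
  have hrneg : r < 0 := lt_of_le_of_lt (hmin w (Finset.mem_sdiff.2 ⟨hw, hwA⟩))
    (div_neg_of_neg_of_pos hwn (hpos w hw hwA))
  refine ⟨V.filter fun v => ψ v = r * φ v, ⟨Finset.filter_subset _ _, ψ - r • φ, fun v hv => ?_⟩,
    ?_, fun x hx hxA => ?_⟩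
  · simp only [LinearMap.sub_apply, LinearMap.smul_apply, smul_eq_mul, Finset.mem_filter, hv,
      true_and, sub_eq_zero, iff_self, and_true, sub_nonneg]
    by_cases hvA : v ∈ A
    · rw [hψ v hvA, (hφ v hv).2.2 hvA, mul_zero]
    · exact (le_div_iff₀ (hpos v hv hvA)).1 (hmin v (Finset.mem_sdiff.2 ⟨hv, hvA⟩))
  · refine Finset.ssubset_iff_of_subset (fun v hv => ?_) |>.2 ⟨m, ?_, hm.2⟩
    · simp [hA hv, hψ v hv, (hφ v (hA hv)).2.2 hv]
    · simp [hm.1, hr, (hpos m hm.1 hm.2).ne']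
  · rw [Finset.mem_filter] at hx
    rw [hx.2]
    exact mul_neg_of_neg_of_pos hrneg (hpos x hx.1 hxA)

/-- In a minimal-rank face `G` properly above `A`, a rank gap of two or more leaves room for a
functional vanishing on `A` and some `u ∈ G \ A` but not on all of `G`. Tilting by it gives a
smaller face that misses `u`. -/
theorem exists_cover (h : IsFace V A) (hAV : A ⊂ V) :
    ∃ H, IsFace V H ∧ A ⊆ H ∧ rk H = rk A + 1 := by
  classical
  obtain ⟨G, hG, hmin⟩ := Finset.exists_min_image
    (V.powerset.filter fun G => IsFace V G ∧ A ⊂ G) rk ⟨V, by simp [self, hAV]⟩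
  simp only [Finset.mem_filter, Finset.mem_powerset] at hG hmin
  obtain ⟨hGV, hGf, hAG⟩ := hG
  refine ⟨G, hGf, hAG.1, ?_⟩
  have hlt := h.rk_lt hAG hGV
  by_contra hne
  obtain ⟨u, hu, huA⟩ := Finset.exists_of_ssubset hAG
  have : ∃ w ∈ G, w ∉ Submodule.span ℝ (insert u A : Set W) := by
    by_contra! hcon
    have hle : rk G ≤ rk (insert u A) := by
      have := FiniteDimensional.span_finset ℝ (insert u A)
      refine Submodule.finrank_mono (Submodule.span_le.2 fun w hw => ?_)
      rw [Finset.coe_insert]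
      exact hcon w hw
    have h2 : rk (insert u A) ≤ rk A + 1 := by
      unfold rk
      rw [Finset.coe_insert, Set.insert_eq, Submodule.span_union, add_comm]
      have := FiniteDimensional.span_finset ℝ A
      exact (Submodule.finrank_add_le_finrank_add_finrank _ _).trans
        (Nat.add_le_add_right (by simpa using finrank_span_le_card (R := ℝ) ({u} : Set W)) _)
    omega
  obtain ⟨w, hw, hws⟩ := this
  obtain ⟨ψ, hψw, hψ⟩ := Submodule.exists_le_ker_of_notMem hws
  have hz : ∀ x ∈ (insert u A : Set W), ψ x = 0 := fun x hx => hψ (Submodule.subset_span hx)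
  have key : ∀ χ : W →ₗ[ℝ] ℝ, χ w < 0 → (∀ x ∈ (insert u A : Set W), χ x = 0) → False := by
    intro χ hχ hχ0
    obtain ⟨G', hG', hAG', hn⟩ := (h.mono hAG.1 hGV).exists_neg
      (fun x hx => hχ0 x (Set.mem_insert_of_mem _ hx)) ⟨w, hw, hχ⟩
    have huG' : u ∉ G' := fun hh => by
      have := hn u hh huA
      rw [hχ0 u (Set.mem_insert _ _)] at this
      exact lt_irrefl _ this
    have hss : G' ⊂ G := hG'.subset.ssubset_of_ne fun e => huG' (e ▸ hu)
    have := hmin G' ⟨hG'.subset.trans hGV, hG'.trans hGf, hAG'⟩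
    exact absurd (hG'.rk_lt hss subset_rfl) (by omega)
  rcases lt_or_gt_of_ne hψw with h1 | h1
  · exact key ψ h1 hz
  · exact key (-ψ) (by simpa using h1) fun x hx => by simp [hz x hx]

theorem exists_neg_cover (h : IsFace V A) {ψ : W →ₗ[ℝ] ℝ} (hψ : ∀ x ∈ A, ψ x = 0)
    (hneg : ∃ w ∈ V, ψ w < 0) :
    ∃ H, IsFace V H ∧ A ⊆ H ∧ rk H = rk A + 1 ∧ ∀ x ∈ H, x ∉ A → ψ x < 0 := by
  obtain ⟨G, hG, hAG, hn⟩ := h.exists_neg hψ hneg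
  obtain ⟨H, hH, hAH, hr⟩ := (h.mono hAG.1 hG.subset).exists_cover hAG
  exact ⟨H, hH.trans hG, hAH, hr, fun x hx => hn x (hH.subset hx)⟩

end IsFace

open Classical in
/-- The faces of `V` of rank `k`. -/
noncomputable def faceSet (V : Finset W) (k : ℕ) : Finset (Finset W) :=
  V.powerset.filter fun A => IsFace V A ∧ rk A = k

theorem mem_faceSet {V A : Finset W} {k : ℕ} : A ∈ faceSet V k ↔ IsFace V A ∧ rk A = k := by
  simp only [faceSet, Finset.mem_filter, Finset.mem_powerset, and_iff_right_iff_imp]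
  exact fun h => h.1.subset

/-! ### Upward covers and local counts -/

open Classical in
/-- The faces of rank `k` of `V` containing `F` on which `ψ` is positive outside `F`. -/
noncomputable def upFaces (V F : Finset W) (ψ : W →ₗ[ℝ] ℝ) (k : ℕ) : Finset (Finset W) :=
  (faceSet V k).filter fun H => F ⊆ H ∧ ∀ x ∈ H, x ∉ F → 0 < ψ x

theorem mem_upFaces {V F H : Finset W} {ψ : W →ₗ[ℝ] ℝ} {k : ℕ} :
    H ∈ upFaces V F ψ k ↔ (IsFace V H ∧ rk H = k) ∧ F ⊆ H ∧ ∀ x ∈ H, x ∉ F → 0 < ψ x := by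
  simp only [upFaces, Finset.mem_filter, mem_faceSet]

namespace IsFace

variable {V F H H' : Finset W}

theorem exists_mem_notMem (hr : rk F < rk H) : ∃ x ∈ H, x ∉ F := by
  by_contra! hcon
  exact absurd (rk_mono hcon) (by omega)

theorem cover_unique (hF : IsFace V F) (hH : IsFace V H) (hH' : IsFace V H') (hFH : F ⊆ H)
    (hFH' : F ⊆ H') (hr : rk H = rk F + 1) (hr' : rk H' = rk F + 1) {x : W} (hx : x ∈ H)
    (hx' : x ∈ H') (hxF : x ∉ F) : H = H' := by
  classical
  have hI := hH.inter hH'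
  have hlt : rk F < rk (H ∩ H') := hF.rk_lt
    (Finset.ssubset_iff_of_subset (Finset.subset_inter hFH hFH') |>.2
      ⟨x, Finset.mem_inter.2 ⟨hx, hx'⟩, hxF⟩) hI.subset
  rw [← hI.eq_of_rk_le Finset.inter_subset_left hH.subset (by omega)]
  exact hI.eq_of_rk_le Finset.inter_subset_right hH'.subset (by omega)

/-- One pivot of a simplex-like walk from `H` towards `H'`, minimizing the slope `φ / ψ`, which is
zero on `H' \ F`. Modulo `F` the face `H` is spanned by `h`, so `ψ h • φ - φ h • ψ` vanishes on `H`;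
it is negative on `H' \ F`, and tilting by it yields `G`. -/
theorem exists_up_step (hF : IsFace V F) {ψ : W →ₗ[ℝ] ℝ} (hψ : ∀ x ∈ F, ψ x = 0)
    (hH : H ∈ upFaces V F ψ (rk F + 1)) (hH' : H' ∈ upFaces V F ψ (rk F + 1)) (hne : H ≠ H')
    {φ : W →ₗ[ℝ] ℝ} (hφ : ∀ v ∈ V, 0 ≤ φ v ∧ (φ v = 0 ↔ v ∈ H')) :
    ∃ h ∈ H, h ∉ F ∧ ∃ G ∈ upFaces V F ψ (rk F + 2), H ⊆ G ∧
      ∀ x ∈ G, x ∉ H → ψ h * φ x < φ h * ψ x := by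
  rw [mem_upFaces] at hH hH'
  obtain ⟨⟨hHf, hHr⟩, hFH, hHu⟩ := hH
  obtain ⟨⟨hHf', hHr'⟩, hFH', hHu'⟩ := hH'
  obtain ⟨h, hh, hhF⟩ := exists_mem_notMem (show rk F < rk H by omega)
  obtain ⟨h', hh', hhF'⟩ := exists_mem_notMem (show rk F < rk H' by omega)
  have hφF : ∀ x ∈ F, φ x = 0 := fun x hx => (hφ x (hF.subset hx)).2.2 (hFH' hx)
  have hφh : 0 < φ h := lt_of_le_of_ne (hφ h (hHf.subset hh)).1 fun e => hne <|
    hF.cover_unique hHf hHf' hFH hFH' hHr hHr' hh ((hφ h (hHf.subset hh)).2.1 e.symm) hhF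
  have hψh := hHu h hh hhF
  have hχ : ∀ x ∈ H, (ψ h • φ - φ h • ψ) x = 0 := by
    intro x hx
    obtain ⟨a, z, hz, rfl⟩ := mem_span_of_rk_le hFH hh (hF.notMem_span (hHf.subset hh) hhF)
      hHr.le hx
    simp only [LinearMap.sub_apply, LinearMap.smul_apply, map_add, map_smul, smul_eq_mul,
      eq_zero_of_mem_span hφF hz, eq_zero_of_mem_span hψ hz]
    ring
  obtain ⟨G, hG, hHG, hGr, hGn⟩ := hHf.exists_neg_cover hχ ⟨h', hHf'.subset hh', by
    have := mul_pos hφh (hHu' h' hh' hhF')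
    simp only [LinearMap.sub_apply, LinearMap.smul_apply, smul_eq_mul,
      (hφ h' (hHf'.subset hh')).2.2 hh']
    linarith⟩
  have hGn' : ∀ x ∈ G, x ∉ H → ψ h * φ x < φ h * ψ x := fun x hx hxH => by
    have := hGn x hx hxH
    simp only [LinearMap.sub_apply, LinearMap.smul_apply, smul_eq_mul] at this
    linarith
  refine ⟨h, hh, hhF, G, mem_upFaces.2 ⟨⟨hG, by omega⟩, hFH.trans hHG, fun x hx hxF => ?_⟩, hHG,
    hGn'⟩
  by_cases hxH : x ∈ H
  · exact hHu x hxH hxF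
  · have h1 := hGn' x hx hxH
    have h2 := mul_nonneg hψh.le (hφ x (hG.subset hx)).1
    exact pos_of_mul_pos_right (h2.trans_lt h1) hφh.le

/-- The graph of upward covers of `F`, joined by upward faces of the next rank, is connected; in
counting form. -/
theorem card_upFaces_le (hF : IsFace V F) {ψ : W →ₗ[ℝ] ℝ} (hψ : ∀ x ∈ F, ψ x = 0) :
    (upFaces V F ψ (rk F + 1)).card ≤ (upFaces V F ψ (rk F + 2)).card + 1 := by
  classical
  rcases (upFaces V F ψ (rk F + 1)).eq_empty_or_nonempty with he | ⟨H', hH'⟩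
  · simp [he]
  obtain ⟨φ, hφ⟩ := (mem_upFaces.1 hH').1.1.2
  rw [← Finset.card_erase_add_one hH']
  refine Nat.add_le_add_right ?_ 1
  have key : ∀ H ∈ (upFaces V F ψ (rk F + 1)).erase H', ∃ h ∈ H, h ∉ F ∧
      ∃ G ∈ upFaces V F ψ (rk F + 2), H ⊆ G ∧ ∀ x ∈ G, x ∉ H → ψ h * φ x < φ h * ψ x :=
    fun H hH => hF.exists_up_step hψ (Finset.mem_of_mem_erase hH) hH' (Finset.ne_of_mem_erase hH) hφ
  choose! h hh hhF G hG hHG hlt using key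
  -- `H` is recovered from `G H` as the part of largest slope `φ / ψ`: two different candidates in
  -- the same `G` would each have slope strictly below the other.
  refine Finset.card_le_card_of_injOn G hG fun H₁ h₁ H₂ h₂ he => ?_
  by_contra hne
  have m₁ := mem_upFaces.1 (Finset.mem_of_mem_erase h₁)
  have m₂ := mem_upFaces.1 (Finset.mem_of_mem_erase h₂)
  have n₁ : h H₁ ∉ H₂ := fun hc => hne <| hF.cover_unique m₁.1.1 m₂.1.1 m₁.2.1 m₂.2.1 m₁.1.2
    m₂.1.2 (hh H₁ h₁) hc (hhF H₁ h₁)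
  have n₂ : h H₂ ∉ H₁ := fun hc => hne <| hF.cover_unique m₁.1.1 m₂.1.1 m₁.2.1 m₂.2.1 m₁.1.2
    m₂.1.2 hc (hh H₂ h₂) (hhF H₂ h₂)
  have l₁ := hlt H₁ h₁ (h H₂) (he ▸ hHG H₂ h₂ (hh H₂ h₂)) n₂
  have l₂ := hlt H₂ h₂ (h H₁) (he ▸ hHG H₁ h₁ (hh H₁ h₁)) n₁
  linarith

theorem up_cover_unique (hF : IsFace V F) {ψ : W →ₗ[ℝ] ℝ} (hψ : ∀ x ∈ F, ψ x = 0)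
    (hno : ∀ G, IsFace V G → rk G = rk F + 2 → F ⊆ G → ∃ x ∈ G, x ∉ F ∧ ψ x ≤ 0)
    (hH : H ∈ upFaces V F ψ (rk F + 1)) (hH' : H' ∈ upFaces V F ψ (rk F + 1)) : H = H' := by
  have he : upFaces V F ψ (rk F + 2) = ∅ := by
    refine Finset.eq_empty_of_forall_notMem fun G hG => ?_
    obtain ⟨⟨hG, hr⟩, hFG, hu⟩ := mem_upFaces.1 hG
    obtain ⟨x, hx, hxF, hle⟩ := hno G hG hr hFG
    exact absurd (hu x hx hxF) (not_lt.2 hle)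
  have := hF.card_upFaces_le hψ
  rw [he] at this
  exact Finset.card_le_one.1 (by simpa using this) H hH H' hH'

theorem exists_ne_cover (hF : IsFace V F) (hH : IsFace V H) (hFH : F ⊆ H)
    (hHV : rk H < rk V) :
    ∃ H', IsFace V H' ∧ F ⊆ H' ∧ rk H' = rk F + 1 ∧ H' ≠ H := by
  obtain ⟨φ, hφ⟩ := hH.2
  obtain ⟨w, hw, hwH⟩ := exists_mem_notMem hHV
  obtain ⟨H', hH', hFH', hr', hn⟩ := hF.exists_neg_cover (ψ := -φ)
    (fun x hx => by simp [(hφ x (hF.subset hx)).2.2 (hFH hx)])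
    ⟨w, hw, by simpa using lt_of_le_of_ne (hφ w hw).1 fun e => hwH ((hφ w hw).2.1 e.symm)⟩
  refine ⟨H', hH', hFH', hr', ?_⟩
  rintro rfl
  obtain ⟨x, hx, hxF⟩ := exists_mem_notMem (show rk F < rk H' by omega)
  have := hn x hx hxF
  simp [(hφ x (hH'.subset hx)).2.2 hx] at this

-- The upper half of the diamond property: modulo the span of `F` the configuration is planar, and a
-- planar cone has at most two extreme rays.
open Classical in
theorem card_covers_le_two (hF : IsFace V F) (hr : rk V = rk F + 2) :
    ((faceSet V (rk F + 1)).filter (F ⊆ ·)).card ≤ 2 := by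
  by_contra! hcon
  obtain ⟨A, hA, B, hB, C, hC, hAB, hAC, hBC⟩ := Finset.two_lt_card.1 hcon
  simp only [Finset.mem_filter, mem_faceSet] at hA hB hC
  obtain ⟨⟨hA, hAr⟩, hFA⟩ := hA
  obtain ⟨⟨hB, hBr⟩, hFB⟩ := hB
  obtain ⟨⟨hC, hCr⟩, hFC⟩ := hC
  obtain ⟨a, ha, haF⟩ := exists_mem_notMem (show rk F < rk A by omega)
  obtain ⟨b, hb, hbF⟩ := exists_mem_notMem (show rk F < rk B by omega)
  obtain ⟨c, hc, hcF⟩ := exists_mem_notMem (show rk F < rk C by omega)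
  obtain ⟨α, hα⟩ := hA.2
  obtain ⟨β, hβ⟩ := hB.2
  obtain ⟨γ, hγ⟩ := hC.2
  have haV := hA.subset ha
  have hbV := hB.subset hb
  have hcV := hC.subset hc
  have pos : ∀ {X Y : Finset W} {χ : W →ₗ[ℝ] ℝ} {y : W}, (∀ v ∈ V, 0 ≤ χ v ∧ (χ v = 0 ↔ v ∈ X)) →
      IsFace V X → IsFace V Y → F ⊆ X → F ⊆ Y → rk X = rk F + 1 → rk Y = rk F + 1 →
      X ≠ Y → y ∈ Y → y ∉ F → 0 < χ y := fun hχ hX hY h1 h2 h3 h4 hne hy hyF =>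
    lt_of_le_of_ne (hχ _ (hY.subset hy)).1 fun e => hne <|
      hF.cover_unique hX hY h1 h2 h3 h4 ((hχ _ (hY.subset hy)).2.1 e.symm) hy hyF
  have hbA : b ∉ A := fun h => hAB (hF.cover_unique hA hB hFA hFB hAr hBr h hb hbF)
  -- Write `c = t b + s a` modulo the span of `F`. The functionals of `A` and `B` force `t, s > 0`,
  -- so the functional of `C` would be positive at `c`.
  obtain ⟨t, y, hy, hcy⟩ := mem_span_of_rk_le hA.subset hbV (hA.notMem_span hbV hbA) (by omega) hcV
  have hy' : ∃ s : ℝ, ∃ z ∈ Submodule.span ℝ (F : Set W), y = s • a + z := by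
    rw [← Submodule.mem_span_insert]
    refine Submodule.span_le.2 (fun x hx => ?_) hy
    obtain ⟨s, z, hz, rfl⟩ := mem_span_of_rk_le hFA ha (hF.notMem_span haV haF) hAr.le hx
    exact Submodule.mem_span_insert.2 ⟨s, z, hz, rfl⟩
  obtain ⟨s, z, hz, rfl⟩ := hy'
  have zero : ∀ {X : Finset W} {χ : W →ₗ[ℝ] ℝ}, (∀ v ∈ V, 0 ≤ χ v ∧ (χ v = 0 ↔ v ∈ X)) →
      F ⊆ X → χ c = t * χ b + s * χ a := fun hχ hFX => by
    rw [hcy, map_add, map_add, map_smul, map_smul, smul_eq_mul, smul_eq_mul,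
      eq_zero_of_mem_span (fun x hx => (hχ x (hF.subset hx)).2.2 (hFX hx)) hz, add_zero]
  have e1 := zero hα hFA
  have e2 := zero hβ hFB
  have e3 := zero hγ hFC
  rw [(hα a haV).2.2 ha, mul_zero, add_zero] at e1
  rw [(hβ b hbV).2.2 hb, mul_zero, zero_add] at e2
  rw [(hγ c hcV).2.2 hc] at e3
  have ht : 0 < t := by
    have h1 := pos hα hA hC hFA hFC hAr hCr hAC hc hcF
    rw [e1] at h1
    exact pos_of_mul_pos_left h1 (hα b hbV).1
  have hs : 0 < s := by
    have h1 := pos hβ hB hC hFB hFC hBr hCr hBC hc hcF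
    rw [e2] at h1
    exact pos_of_mul_pos_left h1 (hβ a haV).1
  have h1 := mul_pos ht (pos hγ hC hB hFC hFB hCr hBr hBC.symm hb hbF)
  have h2 := mul_pos hs (pos hγ hC hA hFC hFA hCr hAr hAC.symm ha haF)
  linarith

/-- Take a face `M` of maximal rank missing `u`. Were it not a facet, some cover `H` of it would
contain `u`; inside a cover of `H` there is a second cover of `M`, which misses `u` and contradicts
maximality. -/
theorem exists_facet_notMem (h0 : IsFace V ∅) {u : W} (hu : u ∈ V) :
    ∃ A, IsFace V A ∧ rk A + 1 = rk V ∧ u ∉ A := by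
  classical
  obtain ⟨M, hM, hmax⟩ := Finset.exists_max_image
    (V.powerset.filter fun G => IsFace V G ∧ u ∉ G) rk ⟨∅, by simp [h0]⟩
  simp only [Finset.mem_filter, Finset.mem_powerset] at hM hmax
  obtain ⟨hMV, hM, huM⟩ := hM
  have hss : ∀ {X : Finset W}, X ⊆ V → u ∉ X → X ⊂ V := fun h h' =>
    h.ssubset_of_ne fun e => h' (e ▸ hu)
  have hlt := hM.rk_lt (hss hMV huM) subset_rfl
  refine ⟨M, hM, ?_, huM⟩
  by_contra hne
  obtain ⟨H, hH, hMH, hr⟩ := hM.exists_cover (hss hMV huM)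
  have huH : u ∈ H := by
    by_contra hc
    have := hmax H ⟨hH.subset, hH, hc⟩
    omega
  have hHV : H ⊂ V := hH.subset.ssubset_of_ne fun e => by rw [e] at hr; omega
  obtain ⟨G, hG, hHG, hrG⟩ := hH.exists_cover hHV
  obtain ⟨H', hH', hMH', hr', hne'⟩ := (hM.mono (hMH.trans hHG) hG.subset).exists_ne_cover
    (hH.mono hHG hG.subset) hMH (by omega)
  have hH'V := hH'.trans hG
  have huH' : u ∉ H' := fun hc => hne' <|
    hM.cover_unique hH'V hH hMH' hMH hr' hr hc huH huM
  have := hmax H' ⟨hH'V.subset, hH'V, huH'⟩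
  omega

-- `F` and one representative from each cover already span: a functional vanishing on them but not
-- on `V` could be tilted into a cover on which it is negative off `F`, including at that cover's
-- own representative.
open Classical in
theorem rk_le_add_card_covers (hF : IsFace V F) :
    rk V ≤ rk F + ((faceSet V (rk F + 1)).filter (F ⊆ ·)).card := by
  set S := (faceSet V (rk F + 1)).filter (F ⊆ ·) with hS
  have hmem : ∀ H ∈ S, ∃ h ∈ H, h ∉ F := fun H hH => by
    simp only [hS, Finset.mem_filter, mem_faceSet] at hH
    exact exists_mem_notMem (show rk F < rk H by omega)
  choose! h hh hhF using hmem
  by_contra! hcon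
  have hdim : Module.finrank ℝ (Submodule.span ℝ ((F ∪ S.image h : Finset W) : Set W)) < rk V := by
    refine lt_of_le_of_lt ?_ hcon
    rw [Finset.coe_union, Submodule.span_union]
    have := FiniteDimensional.span_finset ℝ F
    have := FiniteDimensional.span_finset ℝ (S.image h)
    exact (Submodule.finrank_add_le_finrank_add_finrank _ _).trans
      (Nat.add_le_add_left ((finrank_span_finset_le_card _).trans Finset.card_image_le) _)
  have : ∃ w ∈ V, w ∉ Submodule.span ℝ ((F ∪ S.image h : Finset W) : Set W) := by
    by_contra! hc
    have := FiniteDimensional.span_finset ℝ (F ∪ S.image h)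
    exact absurd (Submodule.finrank_mono (Submodule.span_le.2 hc)) (not_le.2 hdim)
  obtain ⟨w, hw, hws⟩ := this
  obtain ⟨ψ, hψw, hψ⟩ := Submodule.exists_le_ker_of_notMem hws
  have hz : ∀ x ∈ F ∪ S.image h, ψ x = 0 := fun x hx =>
    hψ (Submodule.subset_span (Finset.mem_coe.2 hx))
  have key : ∀ χ : W →ₗ[ℝ] ℝ, χ w < 0 → (∀ x ∈ F ∪ S.image h, χ x = 0) → False := by
    intro χ hχ hχ0
    obtain ⟨H, hH, hFH, hr, hn⟩ := hF.exists_neg_cover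
      (fun x hx => hχ0 x (Finset.mem_union_left _ hx)) ⟨w, hw, hχ⟩
    have hHS : H ∈ S := by simp [hS, mem_faceSet, hH, hr, hFH]
    have := hn (h H) (hh H hHS) (hhF H hHS)
    rw [hχ0 _ (Finset.mem_union_right _ (Finset.mem_image_of_mem _ hHS))] at this
    exact lt_irrefl _ this
  rcases lt_or_gt_of_ne hψw with h1 | h1
  · exact key ψ h1 hz
  · exact key (-ψ) (by simpa using h1) fun x hx => by simp [hz x hx]

end IsFace

open Classical in
/-- All faces of `V`. -/
noncomputable def faceFinset (V : Finset W) : Finset (Finset W) :=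
  V.powerset.filter (IsFace V)

theorem mem_faceFinset {V A : Finset W} : A ∈ faceFinset V ↔ IsFace V A := by
  simp only [faceFinset, Finset.mem_filter, Finset.mem_powerset, and_iff_right_iff_imp]
  exact fun h => h.subset

theorem faceSet_subset {V C : Finset W} (hC : IsFace V C) (k : ℕ) :
    faceSet C k ⊆ faceSet V k := fun A hA => by
  rw [mem_faceSet] at hA ⊢
  exact ⟨hA.1.trans hC, hA.2⟩

/-- A large multiple of `φ` plus a functional `g` that separates `V`: order by `φ` first and break
ties by `g`. -/
theorem exists_linear_separating_injOn [FiniteDimensional ℝ W] (V : Finset W)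
    (φ : W →ₗ[ℝ] ℝ) : ∃ h : W →ₗ[ℝ] ℝ, Set.InjOn h V ∧
      ∀ x ∈ V, ∀ y ∈ V, φ x < φ y → h x < h y := by
  classical
  obtain ⟨g, hg⟩ := Module.exists_dual_forall_apply_ne_zero (K := ℝ)
    (fun p : {p : V × V // p.1 ≠ p.2} => (p.1.1 : W) - p.1.2)
    (fun p => sub_ne_zero.2 fun e => p.2 (Subtype.ext e))
  obtain ⟨N, hN⟩ := ((V ×ˢ V).image fun p => (g p.1 - g p.2) / (φ p.2 - φ p.1)).bddAbove
  have hmono : ∀ x ∈ V, ∀ y ∈ V, φ x < φ y →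
      (g + (N + 1) • φ) x < (g + (N + 1) • φ) y := by
    intro x hx y hy hlt
    have hle := hN (Finset.mem_coe.2 (Finset.mem_image_of_mem _ (Finset.mk_mem_product hx hy)))
    simp only [div_le_iff₀ (sub_pos.2 hlt)] at hle
    simp only [LinearMap.add_apply, LinearMap.smul_apply, smul_eq_mul]
    linarith
  refine ⟨g + (N + 1) • φ, fun x hx y hy he => ?_, hmono⟩
  by_contra hne
  rcases lt_trichotomy (φ x) (φ y) with h | h | h
  · exact (hmono x hx y hy h).ne he
  · refine hg ⟨(⟨x, hx⟩, ⟨y, hy⟩), fun e => hne (congrArg Subtype.val e)⟩ ?_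
    simp only [LinearMap.add_apply, LinearMap.smul_apply, smul_eq_mul, h, add_left_inj] at he
    simp [he]
  · exact (hmono y hy x hx h).ne' he

section Normalized

/-! ### Global counts for vectors of height one -/

variable {V : Finset W} {φ₀ : W →ₗ[ℝ] ℝ}

theorem isFace_empty (h₀ : ∀ v ∈ V, φ₀ v = 1) : IsFace V ∅ :=
  ⟨Finset.empty_subset V, φ₀, fun v hv => by simp [h₀ v hv]⟩

theorem rk_singleton (h₀ : ∀ v ∈ V, φ₀ v = 1) {v : W} (hv : v ∈ V) : rk {v} = 1 := by
  unfold rk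
  rw [Finset.coe_singleton]
  refine finrank_span_singleton fun e => ?_
  have := h₀ v hv
  simp [e] at this

theorem exists_bot (h₀ : ∀ v ∈ V, φ₀ v = 1) {h : W →ₗ[ℝ] ℝ} (hinj : Set.InjOn h V)
    {A : Finset W} (hA : IsFace V A) (hr : 0 < rk A) :
    ∃ v ∈ A, IsFace V {v} ∧ ∀ x ∈ A, x ∉ ({v} : Finset W) → 0 < (h - h v • φ₀) x := by
  classical
  have hne : A.Nonempty := by
    rw [Finset.nonempty_iff_ne_empty]
    rintro rfl
    simp [rk_empty] at hr
  obtain ⟨v, hv, hmin⟩ := Finset.exists_min_image A h hne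
  have heval : ∀ x ∈ A, (h - h v • φ₀) x = h x - h v := fun x hx => by
    simp [h₀ x (hA.subset hx)]
  refine ⟨v, hv, IsFace.trans (C := A) ⟨by simpa using hv, h - h v • φ₀, fun x hx => ?_⟩ hA,
    fun x hx hxv => ?_⟩
  · rw [heval x hx, Finset.mem_singleton, sub_eq_zero]
    exact ⟨sub_nonneg.2 (hmin x hx), fun e => hinj (hA.subset hx) (hA.subset hv) e, fun e => by rw [e]⟩
  · rw [heval x hx, sub_pos]
    exact lt_of_le_of_ne (hmin x hx) fun e =>
      hxv (Finset.mem_singleton.2 (hinj (hA.subset hx) (hA.subset hv) e.symm))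

/-- Group edges and polygons by their lowest vertex for a generic functional. At each vertex
`card_upFaces_le` bounds the upward edges by the upward polygons plus one; the extra ones sum to the
number of vertices. -/
theorem card_faceSet_two_le [FiniteDimensional ℝ W] (h₀ : ∀ v ∈ V, φ₀ v = 1) :
    (faceSet V 2).card ≤ (faceSet V 1).card + (faceSet V 3).card := by
  classical
  obtain ⟨h, hinj, -⟩ := exists_linear_separating_injOn V φ₀
  have key : ∀ A, IsFace V A ∧ 0 < rk A →
      ∃ v ∈ A, IsFace V {v} ∧ ∀ x ∈ A, x ∉ ({v} : Finset W) → 0 < (h - h v • φ₀) x :=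
    fun A hA => exists_bot h₀ hinj hA.1 hA.2
  choose! bot hbot hface hup using key
  set T := V.filter fun v => IsFace V {v} with hT
  have hTc : T.card ≤ (faceSet V 1).card := by
    refine Finset.card_le_card_of_injOn (fun v => {v}) (fun v hv => ?_) fun v _ w _ e => by simpa using e
    rw [Finset.mem_coe, hT, Finset.mem_filter] at hv
    exact Finset.mem_coe.2 (mem_faceSet.2 ⟨hv.2, rk_singleton h₀ hv.1⟩)
  have maps : ∀ k, 0 < k → ∀ A ∈ faceSet V k, bot A ∈ T := fun k hk A hA => by
    rw [mem_faceSet] at hA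
    have hA' : IsFace V A ∧ 0 < rk A := ⟨hA.1, hA.2 ▸ hk⟩
    exact Finset.mem_filter.2 ⟨hA.1.subset (hbot A hA'), hface A hA'⟩
  rw [Finset.card_eq_sum_card_fiberwise (maps 2 two_pos),
    Finset.card_eq_sum_card_fiberwise (s := faceSet V 3) (maps 3 three_pos)]
  refine le_trans ?_ (Nat.add_le_add_right hTc _)
  rw [Finset.card_eq_sum_ones, ← Finset.sum_add_distrib]
  refine Finset.sum_le_sum fun v hv => ?_
  obtain ⟨hvV, hvF⟩ := Finset.mem_filter.1 hv
  have h1 := rk_singleton h₀ hvV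
  have hc := hvF.card_upFaces_le (ψ := h - h v • φ₀) (by simp [h₀ v hvV])
  rw [h1] at hc
  rw [add_comm]
  refine (Finset.card_le_card fun A hA => ?_).trans (hc.trans (Nat.add_le_add_right
    (Finset.card_le_card fun G hG => ?_) 1))
  · obtain ⟨hAk, rfl⟩ := Finset.mem_filter.1 hA
    replace hA := mem_faceSet.1 hAk
    have hA' : IsFace V A ∧ 0 < rk A := ⟨hA.1, by omega⟩
    exact mem_upFaces.2 ⟨hA, by simpa using hbot A hA', hup A hA'⟩
  · obtain ⟨hG, hvG, hGu⟩ := mem_upFaces.1 hG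
    rw [Finset.singleton_subset_iff] at hvG
    refine Finset.mem_filter.2 ⟨mem_faceSet.2 hG, ?_⟩
    have hG' : IsFace V G ∧ 0 < rk G := ⟨hG.1, by omega⟩
    -- An upward polygon at `v` has `v` as its bottom: otherwise `v` and the bottom would each be
    -- strictly lower than the other.
    by_contra hne
    have e1 := hGu (bot G) (hbot G hG') (by simpa using hne)
    have e2 := hup G hG' v hvG (by simpa using Ne.symm hne)
    simp only [LinearMap.sub_apply, LinearMap.smul_apply, smul_eq_mul, h₀ v hvV,
      h₀ _ (hG.1.subset (hbot G hG'))] at e1 e2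
    linarith

/-- Double counting of incidences: a vertex lies on at least `rk V - 1` edges, an edge has at most
two vertices. -/
theorem card_faceSet_one_mul_le (h₀ : ∀ v ∈ V, φ₀ v = 1) :
    (faceSet V 1).card * (rk V - 1) ≤ (faceSet V 2).card * 2 := by
  classical
  refine Finset.card_mul_le_card_mul (· ⊆ ·) (fun v hv => ?_) fun e he => ?_
  · rw [mem_faceSet] at hv
    have := hv.1.rk_le_add_card_covers
    rw [hv.2] at this
    exact Nat.sub_le_iff_le_add'.2 this
  · rw [mem_faceSet] at he
    have h0e : IsFace e ∅ := (isFace_empty h₀).mono (Finset.empty_subset e) he.1.subset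
    refine le_trans (Finset.card_le_card fun v hv => ?_)
      (h0e.card_covers_le_two (by rw [rk_empty, he.2]))
    obtain ⟨hv, hve⟩ := Finset.mem_filter.1 hv
    rw [mem_faceSet] at hv
    rw [rk_empty]
    exact Finset.mem_filter.2
      ⟨mem_faceSet.2 ⟨hv.1.mono hve he.1.subset, hv.2⟩, Finset.empty_subset v⟩

/-- At least two edges pass through a chosen vertex, and some edge misses it. -/
theorem three_le_card_faceSet_two (h₀ : ∀ v ∈ V, φ₀ v = 1) (hr : rk V = 3) :
    3 ≤ (faceSet V 2).card := by
  classical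
  have h0 := isFace_empty h₀
  obtain ⟨v, hv, -, hvr⟩ := h0.exists_cover
    ((Finset.empty_subset V).ssubset_of_ne fun e => by rw [← e, rk_empty] at hr; omega)
  rw [rk_empty] at hvr
  obtain ⟨u, hu, -⟩ := IsFace.exists_mem_notMem (show rk ∅ < rk v by rw [rk_empty]; omega)
  obtain ⟨A, hA, hAr, huA⟩ := IsFace.exists_facet_notMem h0 (hv.subset hu)
  have hc := hv.rk_le_add_card_covers
  rw [hvr] at hc
  have hlt : ((faceSet V 2).filter (v ⊆ ·)).card < (faceSet V 2).card := by
    refine Finset.card_lt_card (Finset.ssubset_iff_of_subset (Finset.filter_subset _ _) |>.2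
      ⟨A, mem_faceSet.2 ⟨hA, by omega⟩, fun h => huA ((Finset.mem_filter.1 h).2 hu)⟩)
  have : 1 + 1 = 2 := rfl
  rw [zero_add, this] at hc
  omega

theorem card_faceSet_three_mul_le (h₀ : ∀ v ∈ V, φ₀ v = 1) (hr : rk V = 4) :
    (faceSet V 3).card * 3 ≤ (faceSet V 2).card * 2 := by
  classical
  refine Finset.card_mul_le_card_mul (fun G e => e ⊆ G) (fun G hG => ?_) fun e he => ?_
  · rw [mem_faceSet] at hG
    refine (three_le_card_faceSet_two (fun v hv => h₀ v (hG.1.subset hv)) hG.2).trans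
      (Finset.card_le_card fun e he => ?_)
    rw [mem_faceSet] at he
    exact Finset.mem_filter.2 ⟨mem_faceSet.2 ⟨he.1.trans hG.1, he.2⟩, he.1.subset⟩
  · rw [mem_faceSet] at he
    have := he.1.card_covers_le_two (by rw [hr, he.2])
    rwa [he.2] at this

end Normalized

/-! ### Charging faces of a treetope to its base -/

section Base

variable {V B : Finset W} {φ₀ : W →ₗ[ℝ] ℝ}

-- If `K` met the base only in an edge, a facet of `K` avoiding a vector of that edge would meet the
-- base in rank at most one while having rank three, against the treetope condition.
open Classical in
theorem rk_inter_facet (h₀ : ∀ v ∈ V, φ₀ v = 1) (hB : IsFace V B)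
    (htree : ∀ F, IsFace V F → rk (F ∩ B) ≤ 1 → rk F ≤ 2) (hBr : rk B = 4)
    {K : Finset W} (hK : IsFace V K) (hKr : rk K = 4) (hne : K ≠ B) : rk (K ∩ B) = 3 := by
  have hKB := hK.inter hB
  have h1 : 1 < rk (K ∩ B) := by
    by_contra! h
    have := htree K hK h
    omega
  have h2 : rk (K ∩ B) < 4 := by
    rw [← hKr]
    refine hKB.rk_lt (Finset.inter_subset_left.ssubset_of_ne fun e => hne ?_) hK.subset
    exact hK.eq_of_rk_le (Finset.inter_eq_left.1 e) hB.subset (by omega)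
  by_contra h3
  obtain ⟨u, hu, -⟩ := IsFace.exists_mem_notMem (show rk ∅ < rk (K ∩ B) by rw [rk_empty]; omega)
  obtain ⟨A, hA, hAr, huA⟩ := IsFace.exists_facet_notMem
    ((isFace_empty h₀).mono (Finset.empty_subset K) hK.subset) (Finset.mem_of_mem_inter_left hu)
  have hAV := hA.trans hK
  have hlt : rk (A ∩ B) < rk (K ∩ B) := (hAV.inter hB).rk_lt
    (Finset.ssubset_iff_of_subset (Finset.inter_subset_inter_right hA.subset) |>.2
      ⟨u, hu, fun h => huA (Finset.mem_of_mem_inter_left h)⟩) hKB.subset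
  have := htree A hAV (by omega)
  omega

open Classical in
theorem card_filter_subset_faceSet_le (hB : IsFace V B) (k : ℕ) :
    ((faceSet V k).filter (· ⊆ B)).card ≤ (faceSet B k).card := by
  refine Finset.card_le_card fun A hA => ?_
  obtain ⟨hA, hAB⟩ := Finset.mem_filter.1 hA
  rw [mem_faceSet] at hA ⊢
  exact ⟨hA.1.mono hAB hB.subset, hA.2⟩

open Classical in
theorem mem_upFaces_of_inter {φ : W →ₗ[ℝ] ℝ} (hφ : ∀ v ∈ V, 0 ≤ φ v ∧ (φ v = 0 ↔ v ∈ B))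
    {A F : Finset W} (hA : IsFace V A) (hAF : A ∩ B = F) : A ∈ upFaces V F φ (rk A) := by
  subst hAF
  refine mem_upFaces.2 ⟨⟨hA, rfl⟩, Finset.inter_subset_left, fun x hx hxF => ?_⟩
  refine lt_of_le_of_ne (hφ x (hA.subset hx)).1 fun e => hxF (Finset.mem_inter.2 ⟨hx, ?_⟩)
  exact (hφ x (hA.subset hx)).2.1 e.symm

/-- Faces of rank one more than their intersection with the base are determined by it, when the
intersection with the base of a face of the next rank is always larger. -/
theorem eq_of_inter_base_eq [DecidableEq W] (hB : IsFace V B) {F : Finset W} (hF : IsFace V F)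
    (hFB : F ⊆ B)
    (hno : ∀ G, IsFace V G → rk G = rk F + 2 → F ⊆ G → rk F < rk (G ∩ B))
    {A A' : Finset W} (hA : IsFace V A) (hA' : IsFace V A') (hr : rk A = rk F + 1)
    (hr' : rk A' = rk F + 1) (hAF : A ∩ B = F) (hAF' : A' ∩ B = F) : A = A' := by
  obtain ⟨φ, hφ⟩ := hB.2
  refine hF.up_cover_unique (ψ := φ) (fun x hx => (hφ x (hF.subset hx)).2.2 (hFB hx))
    (fun G hG hGr hFG => ?_) (hr ▸ mem_upFaces_of_inter hφ hA (by convert hAF))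
    (hr' ▸ mem_upFaces_of_inter hφ hA' (by convert hAF'))
  obtain ⟨x, hx, hxF⟩ := IsFace.exists_mem_notMem (hno G hG hGr hFG)
  rw [Finset.mem_inter] at hx
  exact ⟨x, hx.1, hxF, ((hφ x (hG.subset hx.1)).2.2 hx.2).le⟩

-- Charge an edge off the base to its lowest vertex `v`, for a generic `h` refining the height `φ`
-- above `B`. Two such edges at `v` would force an upward polygon there. For `v` off the base this
-- fails because every polygon reaches down to `B`; for `v` in the base, because every polygon at
-- `v` meets `B` in more than `v`.
open Classical in
theorem card_edges_le [FiniteDimensional ℝ W] (h₀ : ∀ v ∈ V, φ₀ v = 1) (hB : IsFace V B)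
    (htree : ∀ F, IsFace V F → rk (F ∩ B) ≤ 1 → rk F ≤ 2) :
    (faceSet V 2).card ≤ (faceSet B 2).card + (faceSet V 1).card := by
  rw [← Finset.card_filter_add_card_filter_not (s := faceSet V 2) (· ⊆ B)]
  refine Nat.add_le_add (card_filter_subset_faceSet_le hB 2) ?_
  obtain ⟨φ, hφ⟩ := hB.2
  obtain ⟨h, hinj, hmono⟩ := exists_linear_separating_injOn V φ
  have key : ∀ A, IsFace V A ∧ 0 < rk A →
      ∃ v ∈ A, IsFace V {v} ∧ ∀ x ∈ A, x ∉ ({v} : Finset W) → 0 < (h - h v • φ₀) x :=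
    fun A hA => exists_bot h₀ hinj hA.1 hA.2
  choose! bot hbot hface hup using key
  have hedge : ∀ A ∈ (faceSet V 2).filter (¬ · ⊆ B), (IsFace V A ∧ 0 < rk A) ∧ rk A = 2 ∧ ¬ A ⊆ B := by
    intro A hA
    rw [Finset.mem_filter, mem_faceSet] at hA
    exact ⟨⟨hA.1.1, by omega⟩, hA.1.2, hA.2⟩
  refine Finset.card_le_card_of_injOn (fun A => {bot A}) (fun A hA => ?_) fun A hA A' hA' he => ?_
  · have hA := (hedge A hA).1
    exact Finset.mem_coe.2 (mem_faceSet.2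
      ⟨hface A hA, rk_singleton h₀ (hA.1.subset (hbot A hA))⟩)
  · obtain ⟨hA, hAr, hAB⟩ := hedge A hA
    obtain ⟨hA', hAr', hAB'⟩ := hedge A' hA'
    replace he : bot A = bot A' := Finset.singleton_injective he
    have hvA := hbot A hA
    have hvA' : bot A ∈ A' := he ▸ hbot A' hA'
    have hvF := hface A hA
    have huA := hup A hA
    have huA' := hup A' hA'
    rw [← he] at huA'
    generalize bot A = v at *
    have hvV := hA.1.subset hvA
    have hvr := rk_singleton h₀ hvV
    have htree' : ∀ G, IsFace V G → rk G = rk {v} + 2 → 1 < rk (G ∩ B) := by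
      intro G hG hGr
      by_contra! hc
      have := htree G hG hc
      omega
    by_cases hvB : v ∈ B
    · have hint : ∀ X : Finset W, IsFace V X → rk X = 2 → ¬ X ⊆ B → v ∈ X → X ∩ B = {v} := by
        intro X hX hXr hXB hvX
        have : rk (X ∩ B) < rk X := (hX.inter hB).rk_lt
          (Finset.inter_subset_left.ssubset_of_ne fun e => hXB (Finset.inter_eq_left.1 e)) hX.subset
        exact (hvF.eq_of_rk_le (by simp [hvX, hvB]) (hX.inter hB).subset (by omega)).symm
      exact eq_of_inter_base_eq hB hvF (by simpa using hvB)
        (fun G hG hGr _ => by have := htree' G hG hGr; omega) hA.1 hA'.1 (by omega) (by omega)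
        (hint A hA.1 hAr hAB hvA) (hint A' hA'.1 hAr' hAB' hvA')
    · refine hvF.up_cover_unique (ψ := h - h v • φ₀) (by simp [h₀ v hvV])
        (fun G hG hGr _ => ?_) (mem_upFaces.2 ⟨⟨hA.1, by omega⟩, by simpa using hvA, huA⟩)
        (mem_upFaces.2 ⟨⟨hA'.1, by omega⟩, by simpa using hvA', huA'⟩)
      obtain ⟨x, hx, -⟩ := IsFace.exists_mem_notMem
        (show rk ∅ < rk (G ∩ B) by have := htree' G hG hGr; rw [rk_empty]; omega)
      rw [Finset.mem_inter] at hx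
      have hxV := hG.subset hx.1
      refine ⟨x, hx.1, fun hxv => hvB (Finset.mem_singleton.1 hxv ▸ hx.2), ?_⟩
      have hlt : φ x < φ v := by
        rw [(hφ x hxV).2.2 hx.2]
        exact lt_of_le_of_ne (hφ v hvV).1 fun e => hvB ((hφ v hvV).2.1 e.symm)
      have := hmono x hxV v hvV hlt
      simp only [LinearMap.sub_apply, LinearMap.smul_apply, smul_eq_mul, h₀ x hxV]
      linarith

-- A polygon off the base meets it in an edge, and that edge determines the polygon because every
-- facet meets the base in rank at least three.
open Classical in
theorem card_polygons_le (h₀ : ∀ v ∈ V, φ₀ v = 1) (hB : IsFace V B)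
    (htree : ∀ F, IsFace V F → rk (F ∩ B) ≤ 1 → rk F ≤ 2) (hBr : rk B = 4) :
    (faceSet V 3).card ≤ (faceSet B 3).card + (faceSet B 2).card := by
  rw [← Finset.card_filter_add_card_filter_not (s := faceSet V 3) (· ⊆ B)]
  refine Nat.add_le_add (card_filter_subset_faceSet_le hB 3) ?_
  have hpoly : ∀ A ∈ (faceSet V 3).filter (¬ · ⊆ B), IsFace V A ∧ rk A = 3 ∧ rk (A ∩ B) = 2 := by
    intro A hA
    rw [Finset.mem_filter, mem_faceSet] at hA
    obtain ⟨⟨hA, hAr⟩, hAB⟩ := hA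
    have h1 : rk (A ∩ B) < rk A := (hA.inter hB).rk_lt
      (Finset.inter_subset_left.ssubset_of_ne fun e => hAB (Finset.inter_eq_left.1 e)) hA.subset
    refine ⟨hA, hAr, ?_⟩
    by_contra hc
    have := htree A hA (by omega)
    omega
  refine Finset.card_le_card_of_injOn (· ∩ B) (fun A hA => ?_) fun A hA A' hA' he => ?_
  · obtain ⟨hA, -, hr⟩ := hpoly A hA
    exact Finset.mem_coe.2 (mem_faceSet.2
      ⟨(hA.inter hB).mono Finset.inter_subset_right hB.subset, hr⟩)
  · obtain ⟨hA, hAr, hr⟩ := hpoly A hA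
    obtain ⟨hA', hAr', hr'⟩ := hpoly A' hA'
    refine eq_of_inter_base_eq hB (hA.inter hB) Finset.inter_subset_right
      (fun G hG hGr _ => ?_) hA hA' (by omega) (by omega) rfl he.symm
    by_cases hGB : G = B
    · rw [hGB, Finset.inter_self, hBr, hr]
      omega
    · rw [rk_inter_facet h₀ hB htree hBr hG (by omega) hGB, hr]
      omega

-- A facet other than `B` is determined by the base polygon in which it meets `B`; the next face up
-- is `V` itself, which contains all of `B`.
open Classical in
theorem card_facets_le (h₀ : ∀ v ∈ V, φ₀ v = 1) (hB : IsFace V B)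
    (htree : ∀ F, IsFace V F → rk (F ∩ B) ≤ 1 → rk F ≤ 2) (hBr : rk B = 4) (hV : rk V = 5) :
    (faceSet V 4).card ≤ (faceSet B 3).card + 1 := by
  rw [← Finset.card_erase_add_one (mem_faceSet.2 ⟨hB, hBr⟩ : B ∈ faceSet V 4)]
  refine Nat.add_le_add_right ?_ 1
  have hfac : ∀ A ∈ (faceSet V 4).erase B, IsFace V A ∧ rk A = 4 ∧ rk (A ∩ B) = 3 := by
    intro A hA
    rw [Finset.mem_erase, mem_faceSet] at hA
    exact ⟨hA.2.1, hA.2.2, rk_inter_facet h₀ hB htree hBr hA.2.1 hA.2.2 hA.1⟩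
  refine Finset.card_le_card_of_injOn (· ∩ B) (fun A hA => ?_) fun A hA A' hA' he => ?_
  · obtain ⟨hA, -, hr⟩ := hfac A hA
    exact Finset.mem_coe.2 (mem_faceSet.2
      ⟨(hA.inter hB).mono Finset.inter_subset_right hB.subset, hr⟩)
  · obtain ⟨hA, hAr, hr⟩ := hfac A hA
    obtain ⟨hA', hAr', hr'⟩ := hfac A' hA'
    refine eq_of_inter_base_eq hB (hA.inter hB) Finset.inter_subset_right
      (fun G hG hGr _ => ?_) hA hA' (by omega) (by omega) rfl he.symm
    rw [hG.eq_of_rk_le hG.subset subset_rfl (by omega), Finset.inter_eq_right.2 hB.subset]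
    omega

/-- Each polygon of `B` lies in a second facet, and is recovered as the intersection of that facet
with `B`. -/
theorem card_ridges_le (hB : IsFace V B) (hBr : rk B = 4) (hV : rk V = 5) :
    (faceSet B 3).card ≤ (faceSet V 4).card := by
  classical
  have key : ∀ G ∈ faceSet B 3, ∃ K ∈ faceSet V 4, G = K ∩ B := by
    intro G hG
    rw [mem_faceSet] at hG
    have hGV := hG.1.trans hB
    obtain ⟨K, hK, hGK, hKr, hne⟩ := hGV.exists_ne_cover hB hG.1.subset (by omega)
    refine ⟨K, mem_faceSet.2 ⟨hK, by omega⟩, ?_⟩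
    have hlt : rk (K ∩ B) < rk K := (hK.inter hB).rk_lt
      (Finset.inter_subset_left.ssubset_of_ne fun e => hne
        (hK.eq_of_rk_le (Finset.inter_eq_left.1 e) hB.subset (by omega))) hK.subset
    exact hGV.eq_of_rk_le (Finset.subset_inter hGK hG.1.subset) (hK.inter hB).subset (by omega)
  choose! f hf he using key
  refine Finset.card_le_card_of_injOn f hf fun G hG G' hG' e => ?_
  rw [he G hG, he G' hG', e]

theorem card_faceFinset_le (h₀ : ∀ v ∈ V, φ₀ v = 1) (hV : rk V = 5) :
    (faceFinset V).card ≤ (faceSet V 1).card + (faceSet V 2).card + (faceSet V 3).card +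
      (faceSet V 4).card + 2 := by
  classical
  have hsub : faceFinset V ⊆ {∅, V} ∪ (faceSet V 1 ∪ faceSet V 2 ∪ faceSet V 3 ∪ faceSet V 4) := by
    intro A hA
    rw [mem_faceFinset] at hA
    have hle := rk_mono hA.subset
    by_cases h5 : rk A = 5
    · simp [hA.eq_of_rk_le hA.subset subset_rfl (by omega)]
    by_cases h0 : rk A = 0
    · simp [← (isFace_empty h₀).eq_of_rk_le (Finset.empty_subset A) hA.subset (by omega)]
    · simp only [Finset.mem_union, mem_faceSet, hA, true_and]
      omega
  refine (Finset.card_le_card hsub).trans ((Finset.card_union_le _ _).trans ?_)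
  have h1 := Finset.card_le_two (a := (∅ : Finset W)) (b := V)
  have h2 := Finset.card_union_le (faceSet V 1) (faceSet V 2)
  have h3 := Finset.card_union_le (faceSet V 1 ∪ faceSet V 2) (faceSet V 3)
  have h4 := Finset.card_union_le (faceSet V 1 ∪ faceSet V 2 ∪ faceSet V 3) (faceSet V 4)
  omega

open Classical in
theorem card_faceFinset_le_of_treetope [FiniteDimensional ℝ W] (h₀ : ∀ v ∈ V, φ₀ v = 1)
    (hB : IsFace V B) (htree : ∀ F, IsFace V F → rk (F ∩ B) ≤ 1 → rk F ≤ 2) (hBr : rk B = 4)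
    (hV : rk V = 5) :
    (faceFinset V).card ≤ 20 * (faceSet V 1).card ∧
      (faceFinset V).card ≤ 20 * (faceSet V 4).card := by
  have hB₀ : ∀ v ∈ B, φ₀ v = 1 := fun v hv => h₀ v (hB.subset hv)
  have h1 := card_faceSet_two_le hB₀
  have h2 := card_faceSet_one_mul_le hB₀
  have h3 := card_faceSet_three_mul_le hB₀ hBr
  have h4 := card_faceSet_one_mul_le h₀
  have h5 := card_edges_le h₀ hB htree
  have h6 := card_polygons_le h₀ hB htree hBr
  have h7 := card_facets_le h₀ hB htree hBr hV
  have h8 := card_ridges_le hB hBr hV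
  have h9 := card_faceFinset_le h₀ hV
  have h10 := Finset.card_le_card (faceSet_subset hB 1)
  have h11 : 0 < (faceSet V 4).card := Finset.card_pos.2 ⟨B, mem_faceSet.2 ⟨hB, hBr⟩⟩
  have h12 : 0 < (faceSet V 1).card := by
    obtain ⟨v, hv, -, hr⟩ := (isFace_empty h₀).exists_cover
      ((Finset.empty_subset V).ssubset_of_ne fun e => by rw [← e, rk_empty] at hV; omega)
    exact Finset.card_pos.2 ⟨v, mem_faceSet.2 ⟨hv, by rw [hr, rk_empty]⟩⟩
  -- The inequalities give `b₂ ≤ 3b₁` and `b₂ ≤ 3b₃`, whence totals of at most `12v + 3` and `14f +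
  -- 2`; the constant 20 is not sharp.
  rw [hBr] at h2
  rw [hV] at h4
  omega

end Base

end ConeFaces

/-! ### From polytopes to vector configurations -/

section Homogenization

variable {E : Type*}

/-- The homogenization of a finite set of points: each point `x` becomes the vector `(x, 1)`. -/
def homog (T : Finset E) : Finset (E × ℝ) :=
  T.map ⟨fun x => (x, 1), fun _ _ h => congrArg Prod.fst h⟩

theorem mem_homog {T : Finset E} {x : E × ℝ} : x ∈ homog T ↔ x.1 ∈ T ∧ x.2 = 1 := by
  obtain ⟨x, t⟩ := x
  rw [homog, Finset.mem_map]
  constructor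
  · rintro ⟨y, hy, e⟩
    obtain ⟨rfl, rfl⟩ := Prod.mk.inj e
    exact ⟨hy, rfl⟩
  · rintro ⟨hx, rfl⟩
    exact ⟨x, hx, rfl⟩

open Classical in
/-- The homogenization of the points of `S` lying in `F`. -/
noncomputable def trace (S : Finset E) (F : Set E) : Finset (E × ℝ) :=
  homog (S.filter (· ∈ F))

theorem mem_trace {S : Finset E} {F : Set E} {x : E × ℝ} :
    x ∈ trace S F ↔ (x.1 ∈ S ∧ x.1 ∈ F) ∧ x.2 = 1 := by
  classical
  rw [trace, mem_homog, Finset.mem_filter]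

theorem trace_inter [DecidableEq (E × ℝ)] (S : Finset E) (F G : Set E) :
    trace S (F ∩ G) = trace S F ∩ trace S G := by
  classical
  ext x
  simp only [trace, mem_homog, Finset.mem_filter, Finset.mem_inter, Set.mem_inter_iff]
  tauto

variable [NormedAddCommGroup E] [InnerProductSpace ℝ E]

/-- The span of the lifted points is the line through one of them plus the direction space at height
zero, and the two meet trivially. -/
theorem rk_homog [FiniteDimensional ℝ E] {T : Finset E} (hT : T.Nonempty) :
    rk (homog T) = Module.finrank ℝ (vectorSpan ℝ (T : Set E)) + 1 := by
  obtain ⟨p, hp⟩ := hT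
  have hsp : Submodule.span ℝ (homog T : Set (E × ℝ)) = Submodule.span ℝ {((p, 1) : E × ℝ)} ⊔
      (vectorSpan ℝ (T : Set E)).map (LinearMap.inl ℝ E ℝ) := by
    apply le_antisymm
    · rw [Submodule.span_le]
      rintro ⟨x, t⟩ hx
      obtain ⟨hx, rfl⟩ := mem_homog.1 hx
      refine Submodule.mem_sup.2 ⟨(p, 1), Submodule.mem_span_singleton_self _, (x - p, 0),
        ⟨x - p, vsub_mem_vectorSpan ℝ hx hp, rfl⟩, by simp⟩
    · have hmem : ∀ x ∈ T, ((x, 1) : E × ℝ) ∈ Submodule.span ℝ (homog T : Set (E × ℝ)) :=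
        fun x hx => Submodule.subset_span (mem_homog.2 ⟨hx, rfl⟩)
      refine sup_le ?_ ?_
      · rw [Submodule.span_singleton_le_iff_mem]
        exact hmem p hp
      · rw [vectorSpan_eq_span_vsub_set_right ℝ (Finset.mem_coe.2 hp), Submodule.map_span,
          Submodule.span_le]
        rintro _ ⟨_, ⟨x, hx, rfl⟩, rfl⟩
        simpa using Submodule.sub_mem _ (hmem x hx) (hmem p hp)
  have hdis : Submodule.span ℝ {((p, 1) : E × ℝ)} ⊓
      (vectorSpan ℝ (T : Set E)).map (LinearMap.inl ℝ E ℝ) = ⊥ := by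
    rw [Submodule.eq_bot_iff]
    rintro x ⟨hx, ⟨y, -, rfl⟩⟩
    obtain ⟨c, hc⟩ := Submodule.mem_span_singleton.1 hx
    have h2 := congrArg Prod.snd hc
    simp only [Prod.smul_snd, smul_eq_mul, mul_one, LinearMap.inl_apply] at h2
    rw [← hc, h2, zero_smul]
  have := Submodule.finrank_sup_add_finrank_inf_eq (Submodule.span ℝ {((p, 1) : E × ℝ)})
    ((vectorSpan ℝ (T : Set E)).map (LinearMap.inl ℝ E ℝ))
  rw [hdis, finrank_bot, add_zero, finrank_span_singleton (by simp),
    ← (Submodule.equivMapOfInjective _ LinearMap.inl_injective _).finrank_eq] at this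
  rw [rk, hsp, this, add_comm]

/-- Complementary slackness: in a convex combination that maximizes `l`, only points of `S` that are
themselves maximizers carry weight. -/
theorem face_eq_convexHull {S : Finset E} {F : Set E}
    (hF : IsExposed ℝ (convexHull ℝ (S : Set E)) F) :
    F = convexHull ℝ ((S : Set E) ∩ F) := by
  classical
  rcases F.eq_empty_or_nonempty with rfl | hne
  · simp
  have hcon : Convex ℝ F := hF.convex (convex_convexHull ℝ _)
  obtain ⟨l, hl⟩ := hF hne
  refine Set.Subset.antisymm (fun x hx => ?_) (convexHull_min Set.inter_subset_right hcon)
  have hx' := hx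
  rw [hl] at hx'
  obtain ⟨w, hw0, hw1, hwx⟩ := Finset.mem_convexHull'.1 hx'.1
  have hS : ∀ y ∈ S, l y ≤ l x := fun y hy => hx'.2 y (subset_convexHull ℝ _ hy)
  have hsum : ∑ y ∈ S, w y * (l x - l y) = 0 := by
    simp only [mul_sub, Finset.sum_sub_distrib, ← Finset.sum_mul, hw1, one_mul]
    rw [← hwx, map_sum]
    simp
  have hz := (Finset.sum_eq_zero_iff_of_nonneg
    fun y hy => mul_nonneg (hw0 y hy) (sub_nonneg.2 (hS y hy))).1 hsum
  have hmem : ∀ y ∈ S, y ∉ F → w y = 0 := by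
    intro y hy hyF
    rcases mul_eq_zero.1 (hz y hy) with h | h
    · exact h
    · refine absurd ?_ hyF
      rw [hl]
      exact ⟨subset_convexHull ℝ _ hy, fun z hz => by rw [← sub_eq_zero.1 h]; exact hx'.2 z hz⟩
  have hcoe : ((S : Set E) ∩ F) = (S.filter (· ∈ F) : Finset E) := by
    ext y
    simp
  rw [hcoe, Finset.mem_convexHull']
  refine ⟨w, fun y hy => hw0 y (Finset.mem_filter.1 hy).1, ?_, ?_⟩
  · rw [← hw1]
    exact Finset.sum_filter_of_ne fun y hy h => by_contra fun hyF => h (hmem y hy hyF)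
  · rw [← hwx]
    exact Finset.sum_filter_of_ne fun y hy h =>
      by_contra fun hyF => h (by rw [hmem y hy hyF, zero_smul])

theorem trace_injOn (S : Finset E) : Set.InjOn (trace S) (faces (convexHull ℝ (S : Set E))) := by
  intro F hF G hG h
  have h' := Finset.map_injective _ h
  have hset : (S : Set E) ∩ F = (S : Set E) ∩ G := by
    ext x
    simpa using Finset.ext_iff.1 h' x
  rw [face_eq_convexHull hF, hset, ← face_eq_convexHull hG]

theorem isFace_trace {S : Finset E} {F : Set E} (hF : F ∈ faces (convexHull ℝ (S : Set E))) :
    IsFace (homog S) (trace S F) := by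
  classical
  refine ⟨Finset.map_subset_map.2 (Finset.filter_subset _ _), ?_⟩
  rcases F.eq_empty_or_nonempty with rfl | hne
  · refine ⟨LinearMap.snd ℝ E ℝ, fun v hv => ?_⟩
    simp [(mem_homog.1 hv).2, trace, mem_homog]
  obtain ⟨l, hl⟩ := hF hne
  obtain ⟨p, hp⟩ := hne
  -- The homogenized slack `(x, t) ↦ t * l p - l x`, with `l p` the maximum of `l`.
  refine ⟨l p • LinearMap.snd ℝ E ℝ - (l : E →ₗ[ℝ] ℝ).comp (LinearMap.fst ℝ E ℝ), ?_⟩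
  rintro ⟨x, t⟩ hx
  obtain ⟨hx, rfl⟩ := mem_homog.1 hx
  have hxP : x ∈ convexHull ℝ (S : Set E) := subset_convexHull ℝ _ hx
  rw [hl] at hp
  have hle := hp.2 x hxP
  simp only [LinearMap.sub_apply, LinearMap.smul_apply, LinearMap.snd_apply, LinearMap.comp_apply,
    LinearMap.fst_apply, ContinuousLinearMap.coe_coe, smul_eq_mul, mul_one, sub_nonneg, trace,
    mem_homog, Finset.mem_filter, hle, and_true, true_and, sub_eq_zero]
  rw [hl]
  exact ⟨fun e => ⟨hx, hxP, fun y hy => e ▸ hp.2 y hy⟩, fun h => le_antisymm (h.2.2 p hp.1) hle⟩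

theorem exists_trace_eq [FiniteDimensional ℝ E] {S : Finset E} {A : Finset (E × ℝ)}
    (hA : IsFace (homog S) A) : ∃ F ∈ faces (convexHull ℝ (S : Set E)), trace S F = A := by
  classical
  obtain ⟨hAS, φ, hφ⟩ := hA
  rcases A.eq_empty_or_nonempty with rfl | ⟨⟨p, t⟩, hp⟩
  · exact ⟨∅, fun h => absurd h (by simp), by simp [trace, homog]⟩
  obtain ⟨hpS, rfl⟩ := mem_homog.1 (hAS hp)
  -- Restricting `φ` to height zero and negating turns zeros of `φ` on the lifted points into
  -- maximizers of `l`.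
  set l : E →L[ℝ] ℝ := LinearMap.toContinuousLinearMap (-(φ.comp (LinearMap.inl ℝ E ℝ))) with hl
  have hφl : ∀ x, φ (x, 1) = φ (0, 1) - l x := by
    intro x
    have : ((x, 1) : E × ℝ) = (0, 1) + (x, 0) := by simp
    rw [this, map_add]
    simp [hl]
  have hp0 := (hφ _ (hAS hp)).2.2 hp
  rw [hφl] at hp0
  have hS : ∀ x ∈ S, l x ≤ l p := by
    intro x hx
    have := (hφ (x, 1) (mem_homog.2 ⟨hx, rfl⟩)).1
    rw [hφl] at this
    linarith
  have hP : ∀ x ∈ convexHull ℝ (S : Set E), l x ≤ l p := fun x hx =>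
    convexHull_min (t := {x | l x ≤ l p}) hS (convex_halfSpace_le l.isLinear _) hx
  have hpP : p ∈ convexHull ℝ (S : Set E) := subset_convexHull ℝ _ hpS
  refine ⟨{x ∈ convexHull ℝ (S : Set E) | ∀ y ∈ convexHull ℝ (S : Set E), l y ≤ l x},
    fun _ => ⟨l, rfl⟩, ?_⟩
  ext ⟨x, t⟩
  constructor
  · intro hx
    obtain ⟨⟨hxS, -, hx⟩, rfl⟩ := mem_trace.1 hx
    refine (hφ _ (mem_homog.2 ⟨hxS, rfl⟩)).2.1 ?_
    rw [hφl]
    linarith [hx p hpP, hS x hxS]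
  · intro hx
    obtain ⟨hxS, rfl⟩ := mem_homog.1 (hAS hx)
    have := (hφ _ (hAS hx)).2.2 hx
    rw [hφl] at this
    exact mem_trace.2 ⟨⟨hxS, subset_convexHull ℝ _ hxS, fun y hy =>
      (hP y hy).trans (by linarith)⟩, rfl⟩

theorem dim_eq_rk_trace [FiniteDimensional ℝ E] {S : Finset E} {F : Set E}
    (hF : F ∈ faces (convexHull ℝ (S : Set E))) : dim F = (rk (trace S F) : ℤ) - 1 := by
  classical
  have hconv := face_eq_convexHull hF
  have hcoe : ((S : Set E) ∩ F) = (S.filter (· ∈ F) : Finset E) := by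
    ext y
    simp
  rw [hcoe] at hconv
  by_cases he : F = ∅
  · simp [dim, he, trace, homog, rk_empty]
  · have hne : (S.filter (· ∈ F)).Nonempty := by
      by_contra h
      rw [Finset.not_nonempty_iff_eq_empty] at h
      rw [h] at hconv
      simp [he] at hconv
    rw [dim, if_neg he, trace, rk_homog hne]
    have : vectorSpan ℝ F = vectorSpan ℝ (S.filter (· ∈ F) : Set E) := by
      conv_lhs => rw [hconv]
      rw [← direction_affineSpan, affineSpan_convexHull, direction_affineSpan]
    rw [this]
    push_cast
    ring

theorem subsingleton_of_dim_le_zero [FiniteDimensional ℝ E] {F : Set E} (hF : dim F ≤ 0) :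
    F.Subsingleton := by
  intro x hx y hy
  rw [dim, if_neg (Set.nonempty_iff_ne_empty.1 ⟨x, hx⟩)] at hF
  have h0 : vectorSpan ℝ F = ⊥ := Submodule.finrank_eq_zero.1 (by omega)
  have := vsub_mem_vectorSpan ℝ hx hy
  rw [h0, Submodule.mem_bot] at this
  exact sub_eq_zero.1 this

theorem trace_image_faces [FiniteDimensional ℝ E] (S : Finset E) :
    trace S '' faces (convexHull ℝ (S : Set E)) = faceFinset (homog S) := by
  ext A
  rw [Finset.mem_coe, mem_faceFinset]
  exact ⟨by rintro ⟨F, hF, rfl⟩; exact isFace_trace hF, exists_trace_eq⟩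

theorem ncard_faces_dim_eq [FiniteDimensional ℝ E] (S : Finset E) (k : ℕ) :
    {F | F ∈ faces (convexHull ℝ (S : Set E)) ∧ dim F = (k : ℤ)}.ncard =
      (faceSet (homog S) (k + 1)).card := by
  rw [← Set.ncard_coe_finset, ← Set.InjOn.ncard_image ((trace_injOn S).mono fun F hF => hF.1)]
  congr 1
  ext A
  rw [Finset.mem_coe, mem_faceSet]
  constructor
  · rintro ⟨F, ⟨hF, hd⟩, rfl⟩
    rw [dim_eq_rk_trace hF] at hd
    exact ⟨isFace_trace hF, by omega⟩
  · rintro ⟨hA, hr⟩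
    obtain ⟨F, hF, rfl⟩ := exists_trace_eq hA
    exact ⟨F, ⟨hF, by rw [dim_eq_rk_trace hF]; omega⟩, rfl⟩

end Homogenization

end Treetope

/-! ### The bound for polytopes -/

theorem mainTheorem10 :
    ∃ C : ℕ, ∀ (d : ℕ) (P : Set (EuclideanSpace ℝ (Fin d))),
      Treetope.IsKTreetope 4 P →
        ∀ n : ℕ, ((Treetope.vertices P).ncard = n ∨ (Treetope.facets P).ncard = n) →
          (Treetope.faces P).Finite ∧ (Treetope.faces P).ncard ≤ C * n := by
  classical
  refine ⟨20, ?_⟩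
  rintro d P ⟨⟨B, ⟨S₀, hS₀, rfl⟩, ⟨hB, hBd⟩, htree⟩, hP⟩ n hn
  lift S₀ to Finset (EuclideanSpace ℝ (Fin d)) using hS₀ with S
  open Treetope in
  have hfin : (faces (convexHull ℝ (S : Set (EuclideanSpace ℝ (Fin d))))).Finite :=
    Set.Finite.of_finite_image (trace_image_faces S ▸ Finset.finite_toSet _) (trace_injOn S)
  open Treetope in
  have hcard : (faces (convexHull ℝ (S : Set (EuclideanSpace ℝ (Fin d))))).ncard =
      (faceFinset (homog S)).card := by
    rw [← (trace_injOn S).ncard_image, trace_image_faces, Set.ncard_coe_finset]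
  open Treetope in
  have hV : rk (homog S) = 5 := by
    have hself : convexHull ℝ (S : Set (EuclideanSpace ℝ (Fin d))) ∈ faces (convexHull ℝ S) :=
      IsExposed.refl _
    have htr : trace S (convexHull ℝ (S : Set (EuclideanSpace ℝ (Fin d)))) = homog S := by
      rw [trace, Finset.filter_true_of_mem fun x hx => subset_convexHull ℝ _ hx]
    have := dim_eq_rk_trace hself
    rw [htr, hP] at this
    push_cast at this
    omega
  have hBr : Treetope.rk (Treetope.trace S B) = 4 := by
    have := Treetope.dim_eq_rk_trace hB
    rw [hBd, hP] at this
    push_cast at this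
    omega
  open Treetope in
  have htree' : ∀ A, IsFace (homog S) A → rk (A ∩ trace S B) ≤ 1 → rk A ≤ 2 := by
    intro A hA hr
    obtain ⟨F, hF, rfl⟩ := exists_trace_eq hA
    -- As `F ∩ B` is itself a face, its trace having rank at most one means dimension at most zero,
    -- hence at most one point.
    have hFB : F ∩ B ∈ faces (convexHull ℝ (S : Set (EuclideanSpace ℝ (Fin d)))) :=
      IsExposed.inter hF hB
    have h1 := dim_eq_rk_trace hFB
    rw [trace_inter] at h1
    have h2 := htree F hF (subsingleton_of_dim_le_zero (by omega))
    rw [dim_eq_rk_trace hF] at h2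
    omega
  open Treetope in
  obtain ⟨h1, h4⟩ := card_faceFinset_le_of_treetope (φ₀ := LinearMap.snd ℝ _ ℝ)
    (fun v hv => (mem_homog.1 hv).2) (isFace_trace hB)
    (fun A hA hr => htree' A hA (by convert hr)) hBr hV
  refine ⟨hfin, ?_⟩
  rw [hcard]
  rcases hn with rfl | rfl
  · rw [show (Treetope.vertices _).ncard = _ from Treetope.ncard_faces_dim_eq S 0]
    exact h1
  · have : Treetope.facets (convexHull ℝ (S : Set (EuclideanSpace ℝ (Fin d)))) =
        {F | F ∈ Treetope.faces (convexHull ℝ (S : Set (EuclideanSpace ℝ (Fin d)))) ∧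
          Treetope.dim F = ((3 : ℕ) : ℤ)} := by
      rw [Treetope.facets, hP]
      norm_num
    rw [this, Treetope.ncard_faces_dim_eq S 3]
    exact h4
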